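/- Let $Y$ and $U$ be (real or complex) Hilbert spaces, let $A:D(A)\subset Y\to Y$ generate a $C_0$-semigroup $\{S(t)\}_{t\ge 0}$ on $Y$, and let $B\in\mathcal L(U;Y)$. Write $\mathbb R^+:=(0,+\infty)$. For $T>0$, the system $y'(t)=Ay(t)+Bu(t)$, $t\in\mathbb R^+$, is called $(\mathrm{DC})_T$-stabilizable if there is an $F\in\mathcal L(Y;U)$ such that the closed-loop system $$y'(t)=Ay(t)+BF\,y([t/T]T),\qquad t\in\mathbb R^+,$$ where $[\cdot]$ denotes the integer part, is exponentially stable; that is, there are $M>0$ and $\omega>0$ such that for every $y_0\in Y$ the (mild) solution $y\in C([0,+\infty);Y)$ with $y(0)=y_0$ satisfies $\|y(t)\|_Y\le Me^{-\omega t}\|y_0\|_Y$ for all $t\ge 0$. Let $$\mathcal T:=\{T\in\mathbb R^+:\ \text{the system is } (\mathrm{DC})_T\text{-stabilizable}\}.$$ If $\mathbb R^+\setminus\mathcal T$ is dense in $\mathbb R^+$, then $\mathcal T=\emptyset$. -/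

import Mathlib

open Set Filter Topology

namespace SampledData

section Semigroup

variable {𝕜 : Type*} [RCLike 𝕜] {Y : Type*} [NormedAddCommGroup Y] [InnerProductSpace 𝕜 Y]

/-- `S` is a `C₀`-semigroup (strongly continuous one-parameter semigroup) of bounded linear
operators on `Y`. Only the values `S t` with `0 ≤ t` are meaningful. -/
structure IsC0Semigroup (S : ℝ → Y →L[𝕜] Y) : Prop where
  zero : S 0 = ContinuousLinearMap.id 𝕜 Y
  add : ∀ s t : ℝ, 0 ≤ s → 0 ≤ t → S (s + t) = (S s).comp (S t)
  tendsto_zero : ∀ x : Y, Tendsto (fun t : ℝ => S t x) (𝓝[>] 0) (𝓝 x)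

/-- The unbounded operator `A : D(A) ⊆ Y → Y` generates the `C₀`-semigroup `S`: `D(A)` is exactly
the set of `x` for which `(S h x - x) / h` converges as `h ↓ 0`, and `A x` is this limit. -/
structure Generates (A : Y →ₗ.[𝕜] Y) (S : ℝ → Y →L[𝕜] Y) : Prop where
  isC0Semigroup : IsC0Semigroup S
  mem_domain_iff : ∀ x : Y, x ∈ A.domain ↔
    ∃ z : Y, Tendsto (fun h : ℝ => (h : 𝕜)⁻¹ • (S h x - x)) (𝓝[>] 0) (𝓝 z)
  tendsto_apply : ∀ x : A.domain,
    Tendsto (fun h : ℝ => (h : 𝕜)⁻¹ • (S h x - x)) (𝓝[>] 0) (𝓝 (A x))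

end Semigroup

/-- The `T`-periodic discrete observation operator `H_T`: `(H_T f)(t) = f([t / T] T)`. -/
noncomputable def observe {Y : Type*} (T : ℝ) (f : ℝ → Y) (t : ℝ) : Y :=
  f ((⌊t / T⌋₊ : ℝ) * T)

section System

variable {𝕜 : Type*} [RCLike 𝕜]
  {Y : Type*} [NormedAddCommGroup Y] [InnerProductSpace 𝕜 Y] [NormedSpace ℝ Y]
  {U : Type*} [NormedAddCommGroup U] [InnerProductSpace 𝕜 U]

/-- `y` is the (mild) solution in `C([0, ∞); Y)` of `y'(t) = A y(t) + B u(t)`, `t > 0`,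
`y(0) = y₀`, where `S` is the semigroup generated by `A`. -/
structure IsMildSolution (S : ℝ → Y →L[𝕜] Y) (B : U →L[𝕜] Y) (u : ℝ → U) (y₀ : Y)
    (y : ℝ → Y) : Prop where
  continuousOn : ContinuousOn y (Ici 0)
  eq_add_integral : ∀ t : ℝ, 0 ≤ t → y t = S t y₀ + ∫ s in (0 : ℝ)..t, S (t - s) (B (u s))

/-- The closed-loop system `y'(t) = A y(t) + B F (H_T y)(t)` is exponentially stable. -/
def ClosedLoopExpStable (S : ℝ → Y →L[𝕜] Y) (B : U →L[𝕜] Y) (F : Y →L[𝕜] U) (T : ℝ) : Prop :=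
  ∃ M ω : ℝ, 0 < M ∧ 0 < ω ∧ ∀ (y₀ : Y) (y : ℝ → Y),
    IsMildSolution S B (fun t => F (observe T y t)) y₀ y →
      ∀ t : ℝ, 0 ≤ t → ‖y t‖ ≤ M * Real.exp (-ω * t) * ‖y₀‖

/-- `(DC)_T`-stabilizability: some bounded constant feedback law, applied to the `T`-periodically
sampled state, makes the closed-loop system exponentially stable. -/
def IsDCStabilizable (S : ℝ → Y →L[𝕜] Y) (B : U →L[𝕜] Y) (T : ℝ) : Prop :=
  ∃ F : Y →L[𝕜] U, ClosedLoopExpStable S B F T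

/-- The set `𝒯` of all periods `T > 0` for which the system is `(DC)_T`-stabilizable. -/
def stabilizingPeriods (S : ℝ → Y →L[𝕜] Y) (B : U →L[𝕜] Y) : Set ℝ :=
  {T : ℝ | 0 < T ∧ IsDCStabilizable S B T}

end System

end SampledData

/-! Stabilizing periods are open to the right: if `T` is stabilizing, so is all of `[T, T + δ)` for
some `δ > 0`, and the complement of `𝒯`, missing `(T, T + δ)`, is not dense.

With `W(T) = ∫₀ᵀ S`, sampling turns the system into `x (k + 1) = S(T) x k + W(T) B u k`, and
exponential stability into geometric decay of the powers of `D = S(T) + W(T) B F`. The same `F` need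
not work for `T + ε`, as `S` is not norm continuous. However, `S(T + ε) S(iε) = S((i + 1)ε) S(T)`
and `W` is locally Lipschitz in norm. Hence the open-loop controls `F Dⁱ x`, applied with period `T
+ ε`, lead after `n` steps to `S(nε) Dⁿ x + O(ε)‖x‖` (`exists_norm_openLoop_sub_le`), a contraction
for suitable `n` and small `ε`. Repeating this block gives an `ℓ²` trajectory from every initial
state, and linear-quadratic optimal control converts these into one constant feedback
(`exists_feedback_of_squareSummable`). -/

namespace SampledData

/-! ### Shifts on `ℓ²`. -/

section SquareSummable

variable {𝕜 : Type*} [RCLike 𝕜] {E : Type*} [NormedAddCommGroup E] [InnerProductSpace 𝕜 E]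

theorem memℓp_two_iff {f : ℕ → E} : Memℓp f 2 ↔ Summable fun k => ‖f k‖ ^ 2 := by
  rw [memℓp_gen_iff (by norm_num)]
  norm_num

theorem memℓp_two_tail (z : lp (fun _ : ℕ => E) 2) : Memℓp (fun k => z (k + 1)) 2 :=
  memℓp_two_iff.2 ((summable_nat_add_iff 1).2 (memℓp_two_iff.1 (lp.memℓp z)))

theorem memℓp_two_cons (z : lp (fun _ : ℕ => E) 2) :
    Memℓp (fun k : ℕ => Nat.casesOn (motive := fun _ => E) k 0 z) 2 :=
  memℓp_two_iff.2 ((summable_nat_add_iff 1).1 (memℓp_two_iff.1 (lp.memℓp z)))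

/-- The sequence `z` without its first term. -/
def tail (z : lp (fun _ : ℕ => E) 2) : lp (fun _ : ℕ => E) 2 := ⟨_, memℓp_two_tail z⟩

/-- The sequence `z` preceded by `0`. -/
def consZero (z : lp (fun _ : ℕ => E) 2) : lp (fun _ : ℕ => E) 2 := ⟨_, memℓp_two_cons z⟩

theorem tail_apply (z : lp (fun _ : ℕ => E) 2) (k : ℕ) : tail z k = z (k + 1) := rfl

theorem consZero_zero (z : lp (fun _ : ℕ => E) 2) : consZero z 0 = 0 := rfl

theorem consZero_succ (z : lp (fun _ : ℕ => E) 2) (k : ℕ) : consZero z (k + 1) = z k := rfl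

/-- The two shifts are adjoint; this carries orthogonality over to tails. -/
theorem inner_consZero (w z : lp (fun _ : ℕ => E) 2) :
    inner 𝕜 (consZero w) z = inner 𝕜 w (tail z) := by
  have h := (lp.summable_inner (𝕜 := 𝕜) (consZero w) z).tsum_eq_zero_add
  rw [consZero_zero, inner_zero_left, zero_add] at h
  rw [lp.inner_eq_tsum, lp.inner_eq_tsum, h]
  rfl

theorem norm_sq_eq_add_norm_tail_sq (z : lp (fun _ : ℕ => E) 2) :
    ‖z‖ ^ 2 = ‖z 0‖ ^ 2 + ‖tail z‖ ^ 2 := by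
  have h : ∀ z : lp (fun _ : ℕ => E) 2, ‖z‖ ^ 2 = ∑' k, ‖z k‖ ^ 2 := fun z => by
    have := lp.norm_rpow_eq_tsum (p := 2) (by norm_num) z
    norm_num at this
    exact this
  rw [h z, h (tail z), (memℓp_two_iff.1 (lp.memℓp z)).tsum_eq_zero_add]
  rfl

end SquareSummable

/-! ### Discrete linear-quadratic optimal control. -/

section LinearQuadratic

variable {𝕜 : Type*} [RCLike 𝕜]
  {Y : Type*} [NormedAddCommGroup Y] [InnerProductSpace 𝕜 Y]
  {U : Type*} [NormedAddCommGroup U] [InnerProductSpace 𝕜 U]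

/-- The square-summable state-control pairs of the discrete system `x (k + 1) = G (x k) + K (u k)`
as a subspace of `ℓ²`. -/
def trajectories (G : Y →L[𝕜] Y) (K : U →L[𝕜] Y) :
    Submodule 𝕜 (lp (fun _ : ℕ => WithLp 2 (Y × U)) 2) where
  carrier := {z | ∀ k, (z (k + 1)).fst = G (z k).fst + K (z k).snd}
  zero_mem' := by intro k; simp
  add_mem' := by
    intro a b ha hb k
    simp only [lp.coeFn_add, Pi.add_apply, WithLp.add_fst, WithLp.add_snd, map_add, ha k, hb k]
    abel
  smul_mem' := by
    intro c a ha k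
    simp only [lp.coeFn_smul, Pi.smul_apply, WithLp.smul_fst, WithLp.smul_snd, map_smul, ha k,
      smul_add]

variable (𝕜 Y U) in
/-- The state at time `k`. -/
noncomputable def stateAt (k : ℕ) : lp (fun _ : ℕ => WithLp 2 (Y × U)) 2 →L[𝕜] Y :=
  (WithLp.fstL 2 𝕜 Y U).comp (lp.evalCLM 𝕜 (fun _ : ℕ => WithLp 2 (Y × U)) 2 k)

variable (𝕜 Y U) in
/-- The control at time `k`. -/
noncomputable def controlAt (k : ℕ) : lp (fun _ : ℕ => WithLp 2 (Y × U)) 2 →L[𝕜] U :=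
  (WithLp.sndL 2 𝕜 Y U).comp (lp.evalCLM 𝕜 (fun _ : ℕ => WithLp 2 (Y × U)) 2 k)

theorem isClosed_trajectories (G : Y →L[𝕜] Y) (K : U →L[𝕜] Y) :
    IsClosed (trajectories G K : Set (lp (fun _ : ℕ => WithLp 2 (Y × U)) 2)) := by
  have h : (trajectories G K : Set (lp (fun _ : ℕ => WithLp 2 (Y × U)) 2)) =
      ⋂ k, {z | stateAt 𝕜 Y U (k + 1) z = G (stateAt 𝕜 Y U k z) + K (controlAt 𝕜 Y U k z)} := by
    ext z
    simp only [mem_iInter]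
    exact Iff.rfl
  rw [h]
  exact isClosed_iInter fun k => isClosed_eq (by fun_prop) (by fun_prop)

/-- The square-summable trajectories starting from the state `0`. -/
noncomputable def nullTrajectories (G : Y →L[𝕜] Y) (K : U →L[𝕜] Y) :
    Submodule 𝕜 (lp (fun _ : ℕ => WithLp 2 (Y × U)) 2) :=
  trajectories G K ⊓ (stateAt 𝕜 Y U 0).ker

/-- The trajectories of minimal norm among those with the same initial state. -/
noncomputable def optimalTrajectories (G : Y →L[𝕜] Y) (K : U →L[𝕜] Y) :
    Submodule 𝕜 (lp (fun _ : ℕ => WithLp 2 (Y × U)) 2) :=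
  trajectories G K ⊓ (nullTrajectories G K)ᗮ

/-- Bellman's principle: a null trajectory preceded by `0` is again a null trajectory, so by
adjointness the tail stays orthogonal to all of them. -/
theorem tail_mem_optimalTrajectories {G : Y →L[𝕜] Y} {K : U →L[𝕜] Y}
    {z : lp (fun _ : ℕ => WithLp 2 (Y × U)) 2} (hz : z ∈ optimalTrajectories G K) :
    tail z ∈ optimalTrajectories G K := by
  refine ⟨fun k => hz.1 (k + 1), fun w hw => ?_⟩
  rw [← inner_consZero]
  refine hz.2 _ ⟨?_, ?_⟩
  · rintro (_ | k)
    · have h0 : (w 0).fst = 0 := hw.2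
      simp [consZero_succ, consZero_zero, h0]
    · exact hw.1 k
  · change (consZero w 0).fst = 0
    simp [consZero_zero]

variable [CompleteSpace Y] [CompleteSpace U]

/-- Two optimal trajectories with equal initial state differ by a null trajectory orthogonal to
itself; projecting out the null part of any trajectory gives existence. -/
theorem bijective_stateAt_optimalTrajectories {G : Y →L[𝕜] Y} {K : U →L[𝕜] Y}
    (h : ∀ x : Y, ∃ z ∈ trajectories G K, stateAt 𝕜 Y U 0 z = x) :
    Function.Bijective ((stateAt 𝕜 Y U 0).comp (optimalTrajectories G K).subtypeL) := by
  have hcl : IsClosed (nullTrajectories G K : Set (lp (fun _ : ℕ => WithLp 2 (Y × U)) 2)) :=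
    (isClosed_trajectories G K).inter (ContinuousLinearMap.isClosed_ker _)
  have : CompleteSpace (nullTrajectories G K) := hcl.completeSpace_coe
  constructor
  · rw [injective_iff_map_eq_zero]
    rintro ⟨z, hz⟩ h0
    have h1 : z ∈ nullTrajectories G K := ⟨hz.1, h0⟩
    have h2 : z = 0 := inner_self_eq_zero.1 (hz.2 z h1)
    exact Subtype.ext h2
  · intro x
    obtain ⟨z, hz, rfl⟩ := h x
    obtain ⟨p, hp, o, ho, rfl⟩ := (nullTrajectories G K).exists_add_mem_mem_orthogonal z
    have ho' : o ∈ trajectories G K := by simpa using sub_mem hz hp.1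
    refine ⟨⟨o, ho', ho⟩, ?_⟩
    have h0 : stateAt 𝕜 Y U 0 p = 0 := hp.2
    simp [h0]

/-- If every initial state of `x (k + 1) = G (x k) + K (u k)` has a square-summable trajectory,
then some constant feedback makes the powers of the closed-loop operator decay exponentially. -/
theorem exists_feedback_of_squareSummable (G : Y →L[𝕜] Y) (K : U →L[𝕜] Y)
    (h : ∀ x : Y, ∃ z ∈ trajectories G K, stateAt 𝕜 Y U 0 z = x) :
    ∃ (F : Y →L[𝕜] U) (C ρ : ℝ), 0 < C ∧ 0 < ρ ∧ ρ < 1 ∧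
      ∀ (k : ℕ) (x : Y), ‖((G + K.comp F) ^ k) x‖ ≤ C * ρ ^ k * ‖x‖ := by
  have hcl : IsClosed (optimalTrajectories G K : Set (lp (fun _ : ℕ => WithLp 2 (Y × U)) 2)) :=
    (isClosed_trajectories G K).inter (Submodule.isClosed_orthogonal _)
  have : CompleteSpace (optimalTrajectories G K) := hcl.completeSpace_coe
  have hbij := bijective_stateAt_optimalTrajectories h
  -- The open mapping theorem makes the optimal trajectory a bounded function of the initial state.
  let e := ContinuousLinearEquiv.ofBijective
    ((stateAt 𝕜 Y U 0).comp (optimalTrajectories G K).subtypeL)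
    (LinearMap.ker_eq_bot.2 hbij.1) (LinearMap.range_eq_top.2 hbij.2)
  let L : Y →L[𝕜] lp (fun _ : ℕ => WithLp 2 (Y × U)) 2 :=
    (optimalTrajectories G K).subtypeL.comp (e.symm : Y →L[𝕜] optimalTrajectories G K)
  have hL : ∀ x, L x ∈ optimalTrajectories G K := fun x => (e.symm x).2
  have hL0 : ∀ x, (L x 0).fst = x := fun x => e.apply_symm_apply x
  have huniq : ∀ z ∈ optimalTrajectories G K, z = L (z 0).fst := fun z hz =>
    congrArg Subtype.val (e.symm_apply_apply ⟨z, hz⟩).symm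
  let F : Y →L[𝕜] U := (controlAt 𝕜 Y U 0).comp L
  have htail : ∀ x, tail (L x) = L ((G + K.comp F) x) := fun x => by
    rw [huniq _ (tail_mem_optimalTrajectories (hL x)), tail_apply, (hL x).1 0, hL0]
    rfl
  obtain ⟨c, hc, hLc⟩ := L.bound
  -- The summand `2` forces `C⁻¹ ≤ 1/2`, so that `q = 1 - C⁻¹` below is positive.
  set C : ℝ := c ^ 2 + 2 with hC
  have hC2 : 2 ≤ C := by nlinarith [sq_nonneg c]
  have hVle : ∀ x, ‖L x‖ ^ 2 ≤ C * ‖x‖ ^ 2 := fun x => by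
    have := pow_le_pow_left₀ (norm_nonneg _) (hLc x) 2
    rw [mul_pow] at this
    nlinarith [sq_nonneg ‖x‖]
  have hle0 : ∀ x, ‖x‖ ^ 2 ≤ ‖L x 0‖ ^ 2 := fun x => by
    rw [WithLp.prod_norm_sq_eq_of_L2, hL0]
    nlinarith [sq_nonneg ‖(L x 0).snd‖]
  have hVge : ∀ x, ‖x‖ ^ 2 ≤ ‖L x‖ ^ 2 := fun x => by
    rw [norm_sq_eq_add_norm_tail_sq]
    nlinarith [hle0 x, sq_nonneg ‖tail (L x)‖]
  have hCpos : 0 < C := by linarith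
  set q : ℝ := 1 - C⁻¹ with hq
  have hCi : C⁻¹ ≤ 2⁻¹ := inv_anti₀ (by norm_num) hC2
  have hCi0 : 0 < C⁻¹ := inv_pos.2 hCpos
  have hq0 : 0 < q := by norm_num at hCi; linarith
  have hq1 : q < 1 := by linarith
  -- `‖L x‖ ^ 2` is a Lyapunov function: each step loses at least `‖x‖ ^ 2`, a fixed fraction of it.
  have hdec : ∀ x, ‖L ((G + K.comp F) x)‖ ^ 2 ≤ q * ‖L x‖ ^ 2 := fun x => by
    have h1 := norm_sq_eq_add_norm_tail_sq (L x)
    rw [htail] at h1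
    have h2 : C⁻¹ * ‖L x‖ ^ 2 ≤ ‖x‖ ^ 2 := by
      rw [inv_mul_le_iff₀ hCpos]; exact hVle x
    nlinarith [hle0 x]
  have hiter : ∀ (k : ℕ) (x : Y), ‖L (((G + K.comp F) ^ k) x)‖ ^ 2 ≤ q ^ k * ‖L x‖ ^ 2 := by
    intro k x
    induction k with
    | zero => simp
    | succ k ih =>
      rw [pow_succ' (G + K.comp F), pow_succ' q]
      refine (hdec _).trans ?_
      rw [mul_assoc]
      exact mul_le_mul_of_nonneg_left ih hq0.le
  refine ⟨F, √C, √q, Real.sqrt_pos.2 hCpos, Real.sqrt_pos.2 hq0, ?_, fun k x => ?_⟩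
  · rw [Real.sqrt_lt' one_pos]; simpa using hq1
  · refine le_of_sq_le_sq ?_ (by positivity)
    have h1 : (√C * √q ^ k * ‖x‖) ^ 2 = q ^ k * (C * ‖x‖ ^ 2) := by
      rw [mul_pow, mul_pow, ← pow_mul, mul_comm k 2, pow_mul, Real.sq_sqrt hq0.le,
        Real.sq_sqrt hCpos.le]
      ring
    rw [h1]
    exact (hVge _).trans ((hiter k x).trans (mul_le_mul_of_nonneg_left (hVle x) (by positivity)))

end LinearQuadratic

/-! ### Periodic repetition of a contracting control block. -/

section Blocks

variable {𝕜 : Type*} [RCLike 𝕜]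
  {Y : Type*} [NormedAddCommGroup Y] [InnerProductSpace 𝕜 Y]
  {U : Type*} [NormedAddCommGroup U] [InnerProductSpace 𝕜 U]

/-- The map sending the initial state of `x (k + 1) = G (x k) + K (u k)` to `x k` when the
controls `u k = L k (x 0)` are used. -/
noncomputable def openLoop (G : Y →L[𝕜] Y) (K : U →L[𝕜] Y) (L : ℕ → Y →L[𝕜] U) : ℕ → Y →L[𝕜] Y
  | 0 => ContinuousLinearMap.id 𝕜 Y
  | k + 1 => G.comp (openLoop G K L k) + K.comp (L k)

theorem summable_pow_div {r : ℝ} (h0 : 0 ≤ r) (h1 : r < 1) {n : ℕ} (hn : 0 < n) :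
    Summable fun k : ℕ => r ^ (k / n) := by
  have : NeZero n := ⟨hn.ne'⟩
  rw [← (Nat.divModEquiv n).symm.summable_iff]
  have h : ((fun k : ℕ => r ^ (k / n)) ∘ (Nat.divModEquiv n).symm) =
      fun p : ℕ × Fin n => r ^ p.1 * (fun _ => (1 : ℝ)) p.2 := by
    funext p
    have := congrArg Prod.fst ((Nat.divModEquiv n).apply_symm_apply p)
    simp only [Function.comp_apply, mul_one]
    exact congrArg (r ^ ·) this
  rw [h]
  exact (summable_geometric_of_lt_one h0 h1).mul_of_nonneg (hasSum_fintype _).summable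
    (fun k => pow_nonneg h0 k) (fun _ => zero_le_one)

/-- Repeating a block of `n` open-loop controls that contracts the state yields square-summable
trajectories. -/
theorem exists_trajectory_of_norm_openLoop_lt_one (G : Y →L[𝕜] Y) (K : U →L[𝕜] Y)
    (L : ℕ → Y →L[𝕜] U) {n : ℕ} (hn : 0 < n) (h : ‖openLoop G K L n‖ < 1) (x : Y) :
    ∃ z ∈ trajectories G K, stateAt 𝕜 Y U 0 z = x := by
  set Θ := openLoop G K L n with hΘ
  let f : ℕ → WithLp 2 (Y × U) := fun k => WithLp.toLp 2
    (openLoop G K L (k % n) ((Θ ^ (k / n)) x), L (k % n) ((Θ ^ (k / n)) x))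
  obtain ⟨C, hC⟩ : ∃ C : ℝ, ∀ i < n, ‖openLoop G K L i‖ ^ 2 + ‖L i‖ ^ 2 ≤ C := by
    refine ⟨∑ i ∈ Finset.range n, (‖openLoop G K L i‖ ^ 2 + ‖L i‖ ^ 2), fun i hi => ?_⟩
    exact Finset.single_le_sum (f := fun i => ‖openLoop G K L i‖ ^ 2 + ‖L i‖ ^ 2)
      (fun i _ => by positivity) (Finset.mem_range.2 hi)
  have hC0 : 0 ≤ C := le_trans (by positivity) (hC 0 hn)
  have hf : Memℓp f 2 := by
    rw [memℓp_two_iff]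
    have hs := (summable_pow_div (sq_nonneg ‖Θ‖) (by nlinarith [norm_nonneg Θ]) hn).mul_left
      (C * ‖x‖ ^ 2)
    refine Summable.of_nonneg_of_le (fun k => sq_nonneg _) (fun k => ?_) hs
    rw [WithLp.prod_norm_sq_eq_of_L2]
    have h1 : ‖(Θ ^ (k / n)) x‖ ≤ ‖Θ‖ ^ (k / n) * ‖x‖ := by
      clear_value Θ
      induction k / n with
      | zero => simp
      | succ m ih =>
        rw [pow_succ', pow_succ', mul_assoc]
        exact (Θ.le_opNorm _).trans (mul_le_mul_of_nonneg_left ih (norm_nonneg _))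
    have h2 := pow_le_pow_left₀ (norm_nonneg _)
      ((openLoop G K L (k % n)).le_opNorm ((Θ ^ (k / n)) x)) 2
    have h3 := pow_le_pow_left₀ (norm_nonneg _) ((L (k % n)).le_opNorm ((Θ ^ (k / n)) x)) 2
    have h4 := pow_le_pow_left₀ (norm_nonneg _) h1 2
    calc _ ≤ (‖openLoop G K L (k % n)‖ ^ 2 + ‖L (k % n)‖ ^ 2) * ‖(Θ ^ (k / n)) x‖ ^ 2 := by
          rw [mul_pow] at h2 h3
          rw [add_mul]
          exact add_le_add h2 h3
      _ ≤ C * (‖Θ‖ ^ (k / n) * ‖x‖) ^ 2 := by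
          gcongr
          exact hC _ (Nat.mod_lt _ hn)
      _ = _ := by rw [mul_pow, ← pow_mul, ← pow_mul, mul_comm 2]; ring
  refine ⟨⟨f, hf⟩, fun k => ?_, ?_⟩
  · change openLoop G K L ((k + 1) % n) ((Θ ^ ((k + 1) / n)) x) =
      G (openLoop G K L (k % n) ((Θ ^ (k / n)) x)) + K (L (k % n) ((Θ ^ (k / n)) x))
    have hstep : G (openLoop G K L (k % n) ((Θ ^ (k / n)) x)) + K (L (k % n) ((Θ ^ (k / n)) x)) =
      openLoop G K L (k % n + 1) ((Θ ^ (k / n)) x) := rfl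
    rw [hstep]
    have hdm := Nat.div_add_mod k n
    rcases (Nat.succ_le_of_lt (Nat.mod_lt k hn)).lt_or_eq with hlt | heq
    · have e : k + 1 = (k % n + 1) + n * (k / n) := by omega
      rw [e, Nat.add_mul_mod_self_left, Nat.add_mul_div_left _ _ hn, Nat.mod_eq_of_lt hlt,
        Nat.div_eq_of_lt hlt, zero_add]
    -- At the end of a block the state `Θ ^ (k / n + 1) x` is the starting state of the next one.
    · have e : k + 1 = n * (k / n + 1) := by rw [Nat.mul_add]; omega
      have e' : k % n + 1 = n := heq
      rw [e', e, Nat.mul_mod_right, Nat.mul_div_cancel_left _ hn, pow_succ']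
      rfl
  · change openLoop G K L (0 % n) ((Θ ^ (0 / n)) x) = x
    simp [openLoop]

end Blocks

/-- The real structure on `Y` is not assumed compatible with `𝕜`; commutation is automatic because
continuous additive maps are real-linear. -/
theorem smulCommClass_real (𝕜 Y : Type*) [RCLike 𝕜] [NormedAddCommGroup Y] [NormedSpace 𝕜 Y]
    [NormedSpace ℝ Y] : SMulCommClass ℝ 𝕜 Y where
  smul_comm r a y :=
    (map_real_smul (DistribSMul.toAddMonoidHom Y a) (continuous_const_smul a) r y).symm

/-! ### Bounds, strong continuity and integrals of `C₀`-semigroups. -/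

section C0Semigroup

variable {𝕜 : Type*} [RCLike 𝕜]
  {Y : Type*} [NormedAddCommGroup Y] [InnerProductSpace 𝕜 Y]
  {S : ℝ → Y →L[𝕜] Y}

namespace IsC0Semigroup

theorem apply_add (hS : IsC0Semigroup S) {s t : ℝ} (hs : 0 ≤ s) (ht : 0 ≤ t) (x : Y) :
    S (s + t) x = S s (S t x) := by
  rw [hS.add s t hs ht]; rfl

theorem tendsto_nhdsGE_zero (hS : IsC0Semigroup S) (x : Y) :
    Tendsto (fun t : ℝ => S t x) (𝓝[≥] 0) (𝓝 x) := by
  have h : ContinuousWithinAt (fun t : ℝ => S t x) (Ioi 0) 0 := by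
    simpa [ContinuousWithinAt, hS.zero] using hS.tendsto_zero x
  simpa [ContinuousWithinAt, hS.zero] using continuousWithinAt_Ioi_iff_Ici.1 h

variable [CompleteSpace Y]

/-- Otherwise some `t n → 0` has `‖S (t n)‖ → ∞`, against uniform boundedness, since each orbit
converges along `t n`. -/
theorem exists_bound_near_zero (hS : IsC0Semigroup S) :
    ∃ δ M : ℝ, 0 < δ ∧ 1 ≤ M ∧ ∀ t, 0 ≤ t → t ≤ δ → ‖S t‖ ≤ M := by
  by_contra! hcon
  have h : ∀ n : ℕ, ∃ t : ℝ, 0 ≤ t ∧ t ≤ 1 / ((n : ℝ) + 1) ∧ (n : ℝ) + 1 < ‖S t‖ := fun n =>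
    hcon (1 / ((n : ℝ) + 1)) (n + 1) (by positivity) (by simp)
  choose t ht0 ht1 htn using h
  have hlim : Tendsto t atTop (𝓝[≥] 0) := by
    refine tendsto_nhdsWithin_iff.2 ⟨?_, Eventually.of_forall ht0⟩
    exact squeeze_zero ht0 ht1 tendsto_one_div_add_atTop_nhds_zero_nat
  obtain ⟨C, hC⟩ := banach_steinhaus (g := fun n => S (t n)) fun x => by
    obtain ⟨C, hC⟩ := ((hS.tendsto_nhdsGE_zero x).comp hlim).norm.bddAbove_range
    exact ⟨C, fun n => hC ⟨n, rfl⟩⟩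
  obtain ⟨n, hn⟩ := exists_nat_gt C
  linarith [hC n, htn n]

theorem exists_bound (hS : IsC0Semigroup S) (a : ℝ) :
    ∃ M : ℝ, 1 ≤ M ∧ ∀ t, 0 ≤ t → t ≤ a → ‖S t‖ ≤ M := by
  obtain ⟨δ, M, hδ, hM, hb⟩ := hS.exists_bound_near_zero
  have hM0 : 0 ≤ M := by linarith
  have key : ∀ (n : ℕ) (t : ℝ), 0 ≤ t → t ≤ n * δ → ‖S t‖ ≤ M ^ (n + 1) := by
    intro n
    induction n with
    | zero => intro t h0 h1; simpa using hb t h0 (by simp at h1; linarith)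
    | succ n ih =>
      intro t h0 h1
      push_cast at h1
      rcases le_total t δ with h | h
      · exact (hb t h0 h).trans (le_self_pow₀ hM (by omega))
      · have e : t = δ + (t - δ) := by ring
        rw [e, hS.add δ _ hδ.le (by linarith), pow_succ' M]
        exact (ContinuousLinearMap.opNorm_comp_le _ _).trans
          (mul_le_mul (hb δ hδ.le le_rfl) (ih _ (by linarith) (by linarith)) (norm_nonneg _) hM0)
  obtain ⟨n, hn⟩ := exists_nat_ge (a / δ)
  refine ⟨M ^ (n + 1), one_le_pow₀ hM, fun t h0 h1 => key n t h0 ?_⟩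
  rw [div_le_iff₀ hδ] at hn
  linarith

theorem continuousOn (hS : IsC0Semigroup S) (x : Y) : ContinuousOn (fun t => S t x) (Ici 0) := by
  intro t₀ ht₀
  obtain ⟨M, hM, hb⟩ := hS.exists_bound (t₀ + 1)
  have hlim : Tendsto (fun t : ℝ => M * ‖S |t - t₀| x - x‖) (𝓝[Ici 0] t₀) (𝓝 0) := by
    have h1 : Tendsto (fun t : ℝ => |t - t₀|) (𝓝 t₀) (𝓝[≥] 0) := by
      refine tendsto_nhdsWithin_iff.2 ⟨?_, Eventually.of_forall fun t => mem_Ici.2 (abs_nonneg _)⟩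
      have : Continuous fun t : ℝ => |t - t₀| := by fun_prop
      simpa using this.tendsto t₀
    have h2 := (((hS.tendsto_nhdsGE_zero x).comp h1).sub_const x).norm.const_mul M
    simp only [sub_self, norm_zero, mul_zero] at h2
    exact h2.mono_left nhdsWithin_le_nhds
  refine tendsto_iff_norm_sub_tendsto_zero.2 ?_
  refine squeeze_zero' (Eventually.of_forall fun _ => norm_nonneg _) ?_ hlim
  have hlt : ∀ᶠ t in 𝓝[Ici 0] t₀, t < t₀ + 1 :=
    nhdsWithin_le_nhds (Iio_mem_nhds (by linarith))
  have hclose : ∀ s t : ℝ, 0 ≤ s → s ≤ t → t ≤ t₀ + 1 →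
      ‖S t x - S s x‖ ≤ M * ‖S (t - s) x - x‖ := fun s t hs hst ht => by
    have e : t = s + (t - s) := by ring
    nth_rw 1 [e]
    rw [hS.apply_add hs (by linarith), ← map_sub]
    exact (S s).le_of_opNorm_le (hb s hs (by linarith)) _
  filter_upwards [hlt, self_mem_nhdsWithin] with t h1 h0
  rcases le_total t₀ t with h | h
  · rw [abs_of_nonneg (by linarith)]
    exact hclose t₀ t ht₀ h h1.le
  · rw [abs_of_nonpos (by linarith), neg_sub, norm_sub_rev]
    exact hclose t t₀ h0 h (by linarith)

/-- Since `S` is meaningful only for nonnegative times, `|t|` gives orbits continuous on all of `ℝ`,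
hence integrable on every interval. -/
theorem continuous_abs (hS : IsC0Semigroup S) (x : Y) : Continuous fun t => S |t| x :=
  (hS.continuousOn x).comp_continuous _root_.continuous_abs abs_nonneg

theorem intervalIntegrable_abs (hS : IsC0Semigroup S) (x : Y) (a b : ℝ) :
    IntervalIntegrable (fun s => S |s| x) MeasureTheory.volume a b :=
  (hS.continuous_abs x).intervalIntegrable a b

variable [NormedSpace ℝ Y]

/-- The operator `x ↦ ∫ s in 0..t, S s x`, for `t ≥ 0`. -/
noncomputable def integralOp (hS : IsC0Semigroup S) (t : ℝ) : Y →L[𝕜] Y :=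
  LinearMap.mkContinuousOfExistsBound
    { toFun := fun x => ∫ s in (0 : ℝ)..t, S |s| x
      map_add' := fun x y => by
        simp only [map_add]
        exact intervalIntegral.integral_add (hS.intervalIntegrable_abs x 0 t)
          (hS.intervalIntegrable_abs y 0 t)
      map_smul' := fun c x => by
        have := smulCommClass_real 𝕜 Y
        simp only [map_smul, RingHom.id_apply]
        exact intervalIntegral.integral_smul c _ }
    (by
      obtain ⟨M, hM, hb⟩ := hS.exists_bound |t|
      refine ⟨M * |t|, fun x => ?_⟩
      have := intervalIntegral.norm_integral_le_of_norm_le_const (a := 0) (b := t)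
        (f := fun s => S |s| x) (C := M * ‖x‖) fun s hs => by
          refine (S |s|).le_of_opNorm_le (hb _ (abs_nonneg s) ?_) x
          have := Set.abs_sub_left_of_mem_uIcc (uIoc_subset_uIcc hs)
          simpa using this
      rw [sub_zero] at this
      refine this.trans (le_of_eq ?_)
      ring)

theorem integralOp_apply (hS : IsC0Semigroup S) (t : ℝ) (x : Y) :
    hS.integralOp t x = ∫ s in (0 : ℝ)..t, S |s| x := rfl

theorem integralOp_sub_apply (hS : IsC0Semigroup S) (s t : ℝ) (x : Y) :
    hS.integralOp t x - hS.integralOp s x = ∫ r in s..t, S |r| x :=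
  intervalIntegral.integral_interval_sub_left (hS.intervalIntegrable_abs x 0 t)
    (hS.intervalIntegrable_abs x 0 s)

theorem integralOp_zero (hS : IsC0Semigroup S) : hS.integralOp 0 = 0 := by
  ext x; simp [integralOp_apply]

theorem continuous_integralOp_apply (hS : IsC0Semigroup S) (x : Y) :
    Continuous fun t => hS.integralOp t x :=
  intervalIntegral.continuous_primitive (fun a b => hS.intervalIntegrable_abs x a b) 0

theorem comp_integralOp (hS : IsC0Semigroup S) {a b : ℝ} (ha : 0 ≤ a) (hb : 0 ≤ b) :
    (S a).comp (hS.integralOp b) = hS.integralOp (a + b) - hS.integralOp a := by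
  ext x
  rw [sub_apply, hS.integralOp_sub_apply, ContinuousLinearMap.comp_apply,
    integralOp_apply, ← (S a).intervalIntegral_comp_comm (hS.intervalIntegrable_abs x 0 b)]
  have h := intervalIntegral.integral_comp_add_left (a := 0) (b := b) (fun r => S |r| x) a
  rw [add_zero] at h
  rw [← h]
  refine intervalIntegral.integral_congr fun s hs => ?_
  rw [uIcc_of_le hb] at hs
  rw [abs_of_nonneg hs.1, abs_of_nonneg (add_nonneg ha hs.1), hS.apply_add ha hs.1]

/-- Integration upgrades strong continuity to Lipschitz continuity in operator norm. -/
theorem exists_norm_integralOp_sub_le (hS : IsC0Semigroup S) (a : ℝ) :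
    ∃ M : ℝ, 0 ≤ M ∧ ∀ s t, 0 ≤ s → s ≤ a → 0 ≤ t → t ≤ a →
      ‖hS.integralOp t - hS.integralOp s‖ ≤ M * |t - s| := by
  obtain ⟨M, hM, hb⟩ := hS.exists_bound a
  refine ⟨M, by linarith, fun s t hs hsa ht hta => ?_⟩
  refine ContinuousLinearMap.opNorm_le_bound _ (by positivity) fun x => ?_
  rw [sub_apply, hS.integralOp_sub_apply]
  refine (intervalIntegral.norm_integral_le_of_norm_le_const (C := M * ‖x‖) fun r hr => ?_).trans
    (le_of_eq (by ring))
  have hr' : r ∈ Icc 0 a := uIcc_subset_Icc ⟨hs, hsa⟩ ⟨ht, hta⟩ (uIoc_subset_uIcc hr)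
  rw [abs_of_nonneg hr'.1]
  exact (S r).le_of_opNorm_le (hb r hr'.1 hr'.2) x

end IsC0Semigroup

end C0Semigroup

/-! ### Mild solutions with piecewise constant forcing. -/

section StepControl

theorem natFloor_div_eq {T s : ℝ} (hT : 0 < T) {k : ℕ} (h1 : k * T ≤ s) (h2 : s < (k + 1) * T) :
    ⌊s / T⌋₊ = k := by
  have h0 : 0 ≤ (k : ℝ) * T := by positivity
  rw [Nat.floor_eq_iff (div_nonneg (by linarith) hT.le), le_div_iff₀ hT, div_lt_iff₀ hT]
  exact ⟨h1, h2⟩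

theorem exists_nat_mul_le {T t : ℝ} (hT : 0 < T) (ht : 0 ≤ t) :
    ∃ k : ℕ, k * T ≤ t ∧ t ≤ (k + 1) * T := by
  refine ⟨⌊t / T⌋₊, ?_, ?_⟩
  · rw [← le_div_iff₀ hT]; exact Nat.floor_le (by positivity)
  · rw [← div_le_iff₀ hT]; exact (Nat.lt_floor_add_one _).le

variable {𝕜 : Type*} [RCLike 𝕜]
  {Y : Type*} [NormedAddCommGroup Y] [InnerProductSpace 𝕜 Y]
  {S : ℝ → Y →L[𝕜] Y}

theorem eqOn_step (S : ℝ → Y →L[𝕜] Y) {T : ℝ} (hT : 0 < T) (v : ℕ → Y) {k : ℕ} {t b : ℝ}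
    (hb : b ≤ (k + 1) * T) (hkb : k * T ≤ b) (hbt : b ≤ t) :
    -- The open interval avoids the right end point, where the floor may jump.
    EqOn (fun s => S |t - s| (v k)) (fun s => S (t - s) (v ⌊s / T⌋₊)) (uIoo (k * T) b) := by
  intro s hs
  rw [uIoo_of_le hkb] at hs
  change S |t - s| (v k) = S (t - s) (v ⌊s / T⌋₊)
  rw [natFloor_div_eq hT hs.1.le (hs.2.trans_le hb), abs_of_nonneg (by linarith [hs.2])]

namespace IsC0Semigroup

variable [CompleteSpace Y]

theorem intervalIntegrable_step_piece (hS : IsC0Semigroup S) {T : ℝ} (hT : 0 < T) (v : ℕ → Y)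
    {k : ℕ} {t b : ℝ} (hb : b ≤ (k + 1) * T) (hkb : k * T ≤ b) (hbt : b ≤ t) :
    IntervalIntegrable (fun s => S (t - s) (v ⌊s / T⌋₊)) MeasureTheory.volume (k * T) b := by
  refine IntervalIntegrable.congr_uIoo ?_ (eqOn_step S hT v hb hkb hbt)
  exact ((hS.continuous_abs (v k)).comp (continuous_const.sub continuous_id)).intervalIntegrable _ _

theorem intervalIntegrable_step (hS : IsC0Semigroup S) {T : ℝ} (hT : 0 < T) (v : ℕ → Y)
    (k : ℕ) {t : ℝ} (hkt : k * T ≤ t) :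
    IntervalIntegrable (fun s => S (t - s) (v ⌊s / T⌋₊)) MeasureTheory.volume 0 (k * T) := by
  induction k with
  | zero => simp
  | succ k ih =>
    push_cast at hkt ⊢
    exact (ih (by linarith)).trans
      (hS.intervalIntegrable_step_piece hT v le_rfl (by linarith) hkt)

variable [NormedSpace ℝ Y]

theorem integral_step_piece (hS : IsC0Semigroup S) {T : ℝ} (hT : 0 < T) (v : ℕ → Y)
    {k : ℕ} {t : ℝ} (hkt : k * T ≤ t) (htk : t ≤ (k + 1) * T) :
    ∫ s in (k * T)..t, S (t - s) (v ⌊s / T⌋₊) = hS.integralOp (t - k * T) (v k) := by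
  rw [← intervalIntegral.integral_congr_uIoo (eqOn_step S hT v htk hkt le_rfl),
    intervalIntegral.integral_comp_sub_left (fun s => S |s| (v k)) t, sub_self, integralOp_apply]

/-- The mild solution with initial value `x` for the forcing term that equals `v k` on
`[k T, (k + 1) T)` can be restarted at the time `k T`. -/
theorem step_solution_restart (hS : IsC0Semigroup S) {T : ℝ} (hT : 0 < T) (v : ℕ → Y) (x : Y)
    {k : ℕ} {t : ℝ} (hkt : k * T ≤ t) (htk : t ≤ (k + 1) * T) :
    S t x + ∫ s in (0 : ℝ)..t, S (t - s) (v ⌊s / T⌋₊) =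
      S (t - k * T) (S (k * T) x + ∫ s in (0 : ℝ)..(k * T), S (k * T - s) (v ⌊s / T⌋₊)) +
        hS.integralOp (t - k * T) (v k) := by
  have h0 : 0 ≤ (k : ℝ) * T := by positivity
  have hd : 0 ≤ t - k * T := by linarith
  rw [← intervalIntegral.integral_add_adjacent_intervals (hS.intervalIntegrable_step hT v k hkt)
      (hS.intervalIntegrable_step_piece hT v htk hkt le_rfl),
    hS.integral_step_piece hT v hkt htk, map_add, ← hS.apply_add hd h0, sub_add_cancel,
    ← (S (t - k * T)).intervalIntegral_comp_comm (hS.intervalIntegrable_step hT v k le_rfl),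
    add_assoc]
  congr 2
  refine intervalIntegral.integral_congr fun s hs => ?_
  rw [uIcc_of_le h0] at hs
  rw [← hS.apply_add hd (by linarith [hs.2])]
  congr 2
  ring

theorem step_solution_continuousOn (hS : IsC0Semigroup S) {T : ℝ} (hT : 0 < T) (v : ℕ → Y)
    (x : Y) : ContinuousOn
      (fun t => S t x + ∫ s in (0 : ℝ)..t, S (t - s) (v ⌊s / T⌋₊)) (Ici 0) := by
  set y := fun t => S t x + ∫ s in (0 : ℝ)..t, S (t - s) (v ⌊s / T⌋₊) with hy
  have hpiece : ∀ k : ℕ, ContinuousOn y (Icc (k * T) ((k + 1) * T)) := fun k => by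
    have hc : ContinuousOn (fun t => S (t - k * T) (y (k * T)) + hS.integralOp (t - k * T) (v k))
        (Icc (k * T) ((k + 1) * T)) := by
      refine ContinuousOn.add ?_ ?_
      · exact (hS.continuousOn _).comp (continuous_id.sub continuous_const).continuousOn
          fun t ht => sub_nonneg.2 ht.1
      · exact ((hS.continuous_integralOp_apply _).comp
          (continuous_id.sub continuous_const)).continuousOn
    exact hc.congr fun t ht => hS.step_solution_restart hT v x ht.1 ht.2
  have hicc : ∀ k : ℕ, ContinuousOn y (Icc 0 (k * T)) := fun k => by
    induction k with
    | zero => simp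
    | succ k ih =>
      have hk : (0 : ℝ) ≤ k * T := by positivity
      push_cast
      rw [← Icc_union_Icc_eq_Icc hk (by linarith : (k : ℝ) * T ≤ (k + 1) * T)]
      exact ih.union_of_isClosed (hpiece k) isClosed_Icc isClosed_Icc
  intro t ht
  obtain ⟨k, hk⟩ := exists_nat_gt (t / T)
  rw [div_lt_iff₀ hT] at hk
  refine (hicc k t ⟨ht, hk.le⟩).mono_of_mem_nhdsWithin ?_
  exact mem_nhdsWithin.2 ⟨Iio (k * T), isOpen_Iio, hk, fun s hs => ⟨hs.2, hs.1.le⟩⟩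

end IsC0Semigroup

end StepControl

/-! ### Sampled closed loop and perturbation of the period. -/

section ClosedLoop

variable {𝕜 : Type*} [RCLike 𝕜]
  {Y : Type*} [NormedAddCommGroup Y] [InnerProductSpace 𝕜 Y] [CompleteSpace Y] [NormedSpace ℝ Y]
  {U : Type*} [NormedAddCommGroup U] [InnerProductSpace 𝕜 U]
  {S : ℝ → Y →L[𝕜] Y}

namespace IsC0Semigroup

/-- The map sending the state at a sampling time to the state at the next one, for the closed-loop
system with feedback `F` and period `T`. -/
noncomputable def closedLoopOp (hS : IsC0Semigroup S) (B : U →L[𝕜] Y) (F : Y →L[𝕜] U) (T : ℝ) :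
    Y →L[𝕜] Y :=
  S T + ((hS.integralOp T).comp B).comp F

theorem mildSolution_restart (hS : IsC0Semigroup S) {B : U →L[𝕜] Y} {F : Y →L[𝕜] U} {T : ℝ}
    (hT : 0 < T) {y₀ : Y} {y : ℝ → Y}
    (hy : IsMildSolution S B (fun t => F (observe T y t)) y₀ y) {k : ℕ} {t : ℝ}
    (hkt : k * T ≤ t) (htk : t ≤ (k + 1) * T) :
    y t = S (t - k * T) (y (k * T)) + hS.integralOp (t - k * T) (B (F (y (k * T)))) := by
  have h0 : 0 ≤ (k : ℝ) * T := by positivity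
  have h := hS.step_solution_restart hT (fun j => B (F (y (j * T)))) y₀ hkt htk
  rw [hy.eq_add_integral t (h0.trans hkt)]
  refine h.trans ?_
  congr 2
  exact (hy.eq_add_integral _ h0).symm

theorem mildSolution_apply_mul (hS : IsC0Semigroup S) {B : U →L[𝕜] Y} {F : Y →L[𝕜] U} {T : ℝ}
    (hT : 0 < T) {y₀ : Y} {y : ℝ → Y}
    (hy : IsMildSolution S B (fun t => F (observe T y t)) y₀ y) (k : ℕ) :
    y (k * T) = (hS.closedLoopOp B F T ^ k) y₀ := by
  induction k with
  | zero => simpa [hS.zero] using hy.eq_add_integral 0 le_rfl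
  | succ k ih =>
    have h := hS.mildSolution_restart hT hy (k := k) (t := (k + 1) * T) (by linarith) le_rfl
    have e : ((k : ℝ) + 1) * T - k * T = T := by ring
    rw [e, ih] at h
    rw [Nat.cast_succ, h, pow_succ']
    rfl

theorem exists_mildSolution (hS : IsC0Semigroup S) (B : U →L[𝕜] Y) (F : Y →L[𝕜] U) {T : ℝ}
    (hT : 0 < T) (y₀ : Y) :
    ∃ y : ℝ → Y, IsMildSolution S B (fun t => F (observe T y t)) y₀ y := by
  set D := hS.closedLoopOp B F T with hD
  let v : ℕ → Y := fun k => B (F ((D ^ k) y₀))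
  let y : ℝ → Y := fun t => S t y₀ + ∫ s in (0 : ℝ)..t, S (t - s) (v ⌊s / T⌋₊)
  have hy : ∀ k : ℕ, y (k * T) = (D ^ k) y₀ := fun k => by
    induction k with
    | zero => simp [y, hS.zero]
    | succ k ih =>
      have h : y ((k + 1) * T) = _ :=
        hS.step_solution_restart hT v y₀ (k := k) (t := (k + 1) * T) (by linarith) le_rfl
      have e : ((k : ℝ) + 1) * T - k * T = T := by ring
      rw [Nat.cast_succ, h, e, pow_succ']
      change S T (y (k * T)) + _ = _
      rw [ih]
      rfl
  refine ⟨y, hS.step_solution_continuousOn hT v y₀, fun t _ => ?_⟩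
  simp only [observe, hy]
  rfl

theorem exists_norm_closedLoopOp_pow_le (hS : IsC0Semigroup S) {B : U →L[𝕜] Y} {F : Y →L[𝕜] U}
    {T : ℝ} (hT : 0 < T) (h : ClosedLoopExpStable S B F T) {c : ℝ} (hc : 0 < c) :
    ∃ n : ℕ, 0 < n ∧ ‖hS.closedLoopOp B F T ^ n‖ ≤ c := by
  obtain ⟨M, ω, hM, hω, hdec⟩ := h
  have hlim : Tendsto (fun n : ℕ => M * Real.exp (-ω * (n * T))) atTop (𝓝 0) := by
    have h1 : Tendsto (fun n : ℕ => ω * T * (n : ℝ)) atTop atTop :=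
      tendsto_natCast_atTop_atTop.const_mul_atTop (mul_pos hω hT)
    have h2 := (Real.tendsto_exp_neg_atTop_nhds_zero.comp h1).const_mul M
    rw [mul_zero] at h2
    refine h2.congr fun n => ?_
    simp only [Function.comp_apply]
    congr 2
    ring
  obtain ⟨n, hn, hn0⟩ := ((hlim.eventually_le_const hc).and (eventually_gt_atTop 0)).exists
  refine ⟨n, hn0, ContinuousLinearMap.opNorm_le_bound _ hc.le fun x => ?_⟩
  -- Stability only speaks of given mild solutions, so existence is needed to bound the operator.
  obtain ⟨y, hy⟩ := hS.exists_mildSolution B F hT x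
  rw [← hS.mildSolution_apply_mul hT hy]
  exact (hdec x y hy _ (by positivity)).trans (mul_le_mul_of_nonneg_right hn (norm_nonneg _))

theorem closedLoopExpStable_of_pow_le (hS : IsC0Semigroup S) {B : U →L[𝕜] Y} {F : Y →L[𝕜] U}
    {T C ρ : ℝ} (hT : 0 < T) (hC : 0 < C) (hρ0 : 0 < ρ) (hρ1 : ρ < 1)
    (h : ∀ (k : ℕ) (x : Y), ‖(hS.closedLoopOp B F T ^ k) x‖ ≤ C * ρ ^ k * ‖x‖) :
    ClosedLoopExpStable S B F T := by
  obtain ⟨M, hM, hb⟩ := hS.exists_bound T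
  obtain ⟨M', hM', hb'⟩ := hS.exists_norm_integralOp_sub_le T
  have hlog : Real.log ρ < 0 := Real.log_neg hρ0 hρ1
  set R : ℝ := M + M' * T * (‖B‖ * ‖F‖) with hR
  have hRpos : 0 < R := by positivity
  -- `R` bounds the growth within one period; `ρ⁻¹` pays for `k` being only at least `t / T - 1`.
  refine ⟨R * C * ρ⁻¹, -Real.log ρ / T, by positivity, div_pos (by linarith) hT,
    fun y₀ y hy t ht => ?_⟩
  obtain ⟨k, hkt, htk⟩ := exists_nat_mul_le hT ht
  have hd0 : 0 ≤ t - k * T := by linarith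
  have hdT : t - k * T ≤ T := by linarith
  have h1 : ‖y t‖ ≤ R * ‖y (k * T)‖ := by
    rw [hS.mildSolution_restart hT hy hkt htk]
    have hW : ‖hS.integralOp (t - k * T)‖ ≤ M' * T := by
      have := hb' 0 (t - k * T) le_rfl hT.le hd0 hdT
      rw [hS.integralOp_zero, sub_zero, sub_zero, abs_of_nonneg hd0] at this
      exact this.trans (mul_le_mul_of_nonneg_left hdT hM')
    have hBF : ‖B (F (y (k * T)))‖ ≤ ‖B‖ * ‖F‖ * ‖y (k * T)‖ := by
      rw [mul_assoc]
      exact (B.le_opNorm _).trans (mul_le_mul_of_nonneg_left (F.le_opNorm _) (norm_nonneg _))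
    calc _ ≤ M * ‖y (k * T)‖ + M' * T * (‖B‖ * ‖F‖ * ‖y (k * T)‖) :=
          (norm_add_le _ _).trans (add_le_add ((S _).le_of_opNorm_le (hb _ hd0 hdT) _)
            ((ContinuousLinearMap.le_of_opNorm_le _ hW _).trans
              (mul_le_mul_of_nonneg_left hBF (by positivity))))
      _ = _ := by rw [hR]; ring
  have h2 : ρ ^ k ≤ ρ⁻¹ * Real.exp (-(-Real.log ρ / T) * t) := by
    have e1 : ρ ^ k = Real.exp (Real.log ρ * k) := by
      rw [← Real.rpow_def_of_pos hρ0, Real.rpow_natCast]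
    have e2 : ρ⁻¹ = Real.exp (-Real.log ρ) := by rw [Real.exp_neg, Real.exp_log hρ0]
    rw [e1, e2, ← Real.exp_add]
    refine Real.exp_le_exp.2 ?_
    have h3 : t / T ≤ k + 1 := (div_le_iff₀ hT).2 htk
    have e3 : -(-Real.log ρ / T) * t = Real.log ρ * (t / T) := by field_simp
    rw [e3]
    nlinarith
  calc ‖y t‖ ≤ R * (C * ρ ^ k * ‖y₀‖) := by
        refine h1.trans (mul_le_mul_of_nonneg_left ?_ hRpos.le)
        rw [hS.mildSolution_apply_mul hT hy]
        exact h k y₀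
    _ ≤ R * (C * (ρ⁻¹ * Real.exp (-(-Real.log ρ / T) * t)) * ‖y₀‖) := by gcongr
    _ = _ := by ring

theorem openLoop_eq_closedLoopOp_pow (hS : IsC0Semigroup S) (B : U →L[𝕜] Y) (F : Y →L[𝕜] U)
    (T : ℝ) (k : ℕ) :
    openLoop (S T) ((hS.integralOp T).comp B) (fun i => F.comp (hS.closedLoopOp B F T ^ i)) k =
      hS.closedLoopOp B F T ^ k := by
  induction k with
  | zero => rfl
  | succ k ih =>
    rw [openLoop, ih, pow_succ']
    rfl

/-- Enlarging the sampling period by `ε` changes the open-loop evolution, up to a shift by the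
semigroup, by `O(ε)` in operator norm. -/
theorem exists_norm_openLoop_sub_le (hS : IsC0Semigroup S) (B : U →L[𝕜] Y) {T : ℝ} (hT : 0 < T)
    (L : ℕ → Y →L[𝕜] U) (i : ℕ) :
    ∃ C : ℝ, ∀ ε, 0 ≤ ε → ε ≤ 1 →
      ‖openLoop (S (T + ε)) ((hS.integralOp (T + ε)).comp B) L i -
        (S (i * ε)).comp (openLoop (S T) ((hS.integralOp T).comp B) L i)‖ ≤ C * ε := by
  induction i with
  | zero =>
    refine ⟨0, fun ε _ _ => ?_⟩
    simp [openLoop, hS.zero]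
  | succ i ih =>
    obtain ⟨C, hC⟩ := ih
    obtain ⟨M, hM, hb⟩ := hS.exists_bound (T + 1)
    -- The largest time that occurs is `(i + 1) * ε + T`.
    obtain ⟨M', hM', hb'⟩ := hS.exists_norm_integralOp_sub_le (T + i + 1)
    have hi0 : (0 : ℝ) ≤ i := i.cast_nonneg
    refine ⟨M * C + (M' * i + M' * (i + 1)) * (‖B‖ * ‖L i‖), fun ε h0 h1 => ?_⟩
    have hiε0 : 0 ≤ (i : ℝ) * ε := by positivity
    have hiε : (i : ℝ) * ε ≤ i := by nlinarith
    have hsplit : (S ((i + 1 : ℝ) * ε)).comp (S T) = (S (T + ε)).comp (S (i * ε)) := by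
      rw [← hS.add _ _ (by positivity) hT.le, ← hS.add _ _ (by positivity) hiε0]
      congr 1; ring
    have hW := hS.comp_integralOp (a := (i + 1 : ℝ) * ε) (by positivity) hT.le
    have e : openLoop (S (T + ε)) ((hS.integralOp (T + ε)).comp B) L (i + 1) -
        (S ((i + 1 : ℕ) * ε)).comp (openLoop (S T) ((hS.integralOp T).comp B) L (i + 1)) =
        (S (T + ε)).comp (openLoop (S (T + ε)) ((hS.integralOp (T + ε)).comp B) L i -
          (S (i * ε)).comp (openLoop (S T) ((hS.integralOp T).comp B) L i)) +
        ((hS.integralOp (T + ε) - hS.integralOp ((i + 1) * ε + T)) +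
          (hS.integralOp ((i + 1) * ε) - hS.integralOp 0)).comp (B.comp (L i)) := by
      push_cast
      simp only [openLoop, ContinuousLinearMap.comp_add, ContinuousLinearMap.comp_sub,
        ContinuousLinearMap.add_comp, ContinuousLinearMap.sub_comp,
        ← ContinuousLinearMap.comp_assoc, hsplit, hW, hS.integralOp_zero,
        ContinuousLinearMap.zero_comp]
      abel
    rw [e]
    have hA : ‖hS.integralOp (T + ε) - hS.integralOp ((i + 1) * ε + T)‖ ≤ M' * i * ε := by
      refine (hb' ((i + 1) * ε + T) (T + ε) (by positivity) (by nlinarith) (by positivity)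
        (by linarith)).trans (le_of_eq ?_)
      rw [show T + ε - ((i + 1) * ε + T) = -(i * ε) by ring, abs_neg, abs_of_nonneg hiε0]
      ring
    have hA' : ‖hS.integralOp ((i + 1) * ε) - hS.integralOp 0‖ ≤ M' * (i + 1) * ε := by
      refine (hb' 0 ((i + 1) * ε) le_rfl (by positivity) (by positivity)
        (by nlinarith)).trans (le_of_eq ?_)
      rw [sub_zero, abs_of_nonneg (by positivity)]
      ring
    calc _ ≤ M * (C * ε) + (M' * i * ε + M' * (i + 1) * ε) * (‖B‖ * ‖L i‖) := by
          refine (norm_add_le _ _).trans (add_le_add ?_ ?_)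
          · exact (ContinuousLinearMap.opNorm_comp_le _ _).trans (mul_le_mul
              (hb _ (by positivity) (by linarith)) (hC ε h0 h1) (norm_nonneg _) (by linarith))
          · refine (ContinuousLinearMap.opNorm_comp_le _ _).trans (mul_le_mul
              ((norm_add_le _ _).trans (add_le_add hA hA'))
              (ContinuousLinearMap.opNorm_comp_le _ _) (norm_nonneg _) (by positivity))
      _ = _ := by ring

/-- Every stabilizing period is the left end point of an interval of stabilizing periods. -/
theorem exists_Ico_subset_stabilizingPeriods [CompleteSpace U] (hS : IsC0Semigroup S)
    {B : U →L[𝕜] Y} {T : ℝ} (h : T ∈ stabilizingPeriods S B) :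
    ∃ δ > 0, Ico T (T + δ) ⊆ stabilizingPeriods S B := by
  obtain ⟨hT, F, hF⟩ := h
  obtain ⟨M, hM, hb⟩ := hS.exists_bound 1
  -- As `n * ε ≤ 1` will hold, `‖S (n * ε)‖ ≤ M`: the shifted power has norm at most `1/2`, leaving
  -- `1/2` for the error `C * ε`.
  obtain ⟨n, hn, hDn⟩ := hS.exists_norm_closedLoopOp_pow_le hT hF (c := (2 * M)⁻¹) (by positivity)
  let L : ℕ → Y →L[𝕜] U := fun i => F.comp (hS.closedLoopOp B F T ^ i)
  obtain ⟨C, hC⟩ := hS.exists_norm_openLoop_sub_le B hT L n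
  have hn' : (0 : ℝ) < n := Nat.cast_pos.2 hn
  have hn1 : (1 : ℝ) ≤ n := by exact_mod_cast hn
  refine ⟨min (n : ℝ)⁻¹ (2 * (|C| + 1))⁻¹, by positivity, fun T' hT' => ?_⟩
  obtain ⟨ε, rfl⟩ : ∃ ε, T' = T + ε := ⟨T' - T, by ring⟩
  have hε0 : 0 ≤ ε := by linarith [hT'.1]
  have hεlt := (add_lt_add_iff_left T).1 hT'.2
  have hnε : n * ε ≤ 1 := by
    have := mul_le_mul_of_nonneg_left (hεlt.le.trans (min_le_left _ _)) hn'.le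
    rwa [mul_inv_cancel₀ hn'.ne'] at this
  have hε1 : ε ≤ 1 := by nlinarith
  have hCε : C * ε < 1 / 2 := by
    have h1 := hεlt.trans_le (min_le_right _ _)
    rw [← one_div, lt_div_iff₀ (by positivity)] at h1
    nlinarith [mul_le_mul_of_nonneg_right (le_abs_self C) hε0]
  have hcontr : ‖openLoop (S (T + ε)) ((hS.integralOp (T + ε)).comp B) L n‖ < 1 := by
    have h1 := hC ε hε0 hε1
    rw [hS.openLoop_eq_closedLoopOp_pow] at h1
    have h2 : ‖(S (n * ε)).comp (hS.closedLoopOp B F T ^ n)‖ ≤ 1 / 2 := by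
      refine (ContinuousLinearMap.opNorm_comp_le _ _).trans ?_
      refine (mul_le_mul (hb _ (by positivity) hnε) hDn (norm_nonneg _) (by linarith)).trans
        (le_of_eq ?_)
      field_simp
    have h3 := norm_le_norm_add_norm_sub' (openLoop (S (T + ε)) ((hS.integralOp (T + ε)).comp B) L n)
      ((S (n * ε)).comp (hS.closedLoopOp B F T ^ n))
    linarith
  obtain ⟨F', C', ρ, hC', hρ0, hρ1, hpow⟩ := exists_feedback_of_squareSummable (S (T + ε))
    ((hS.integralOp (T + ε)).comp B)
    (exists_trajectory_of_norm_openLoop_lt_one _ _ L hn hcontr)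
  exact ⟨by positivity, F', hS.closedLoopExpStable_of_pow_le (by positivity) hC' hρ0 hρ1 hpow⟩

end IsC0Semigroup

end ClosedLoop

end SampledData

theorem corollary4p2 {𝕜 : Type*} [RCLike 𝕜]
    {Y : Type*} [NormedAddCommGroup Y] [InnerProductSpace 𝕜 Y] [CompleteSpace Y] [NormedSpace ℝ Y]
    {U : Type*} [NormedAddCommGroup U] [InnerProductSpace 𝕜 U] [CompleteSpace U]
    (A : Y →ₗ.[𝕜] Y) (S : ℝ → Y →L[𝕜] Y) (hA : SampledData.Generates A S)
    (B : U →L[𝕜] Y)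
    (hdense : Ioi (0 : ℝ) ⊆ closure (Ioi (0 : ℝ) \ SampledData.stabilizingPeriods S B)) :
    SampledData.stabilizingPeriods S B = ∅ := by
  refine eq_empty_of_forall_notMem fun T hT => ?_
  obtain ⟨δ, hδ, hsub⟩ := hA.isC0Semigroup.exists_Ico_subset_stabilizingPeriods hT
  have hmem : T + δ / 2 ∈ Ioi (0 : ℝ) := add_pos hT.1 (half_pos hδ)
  obtain ⟨T', hT', -, hnot⟩ := mem_closure_iff.1 (hdense hmem) (Ioo T (T + δ)) isOpen_Ioo
    ⟨by linarith, by linarith⟩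
  exact hnot (hsub (Ioo_subset_Ico_self hT'))
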